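/- Let $R$ be a commutative Noetherian ring and let $\mathfrak a$ be a proper ideal of $R$. For an $R$-module $M$ let $\Gamma_{\mathfrak a}(M)=\{x\in M : \mathfrak a^n x=0 \text{ for some } n\ge 0\}$, and apply $\Gamma_{\mathfrak a}$ to $R$-complexes degree by degree. A module $M$ is $\Gamma_{\mathfrak a}$-acyclic if $H^i_{\mathfrak a}(M)=(R^i\Gamma_{\mathfrak a})(M)=0$ for all $i>0$. An $R$-complex $I$ is semiinjective if $\operatorname{Hom}_R(-,I)$ converts injective quasiisomorphisms into surjective quasiisomorphisms; a semiinjective resolution of an $R$-complex $M$ is a quasiisomorphism $M\to E$ with $E$ semiinjective, and $\mathbf R\Gamma_{\mathfrak a}(M)$ denotes the object $\Gamma_{\mathfrak a}(E)$ of the derived category $\mathrm D(R)$. Let $C=(\cdots\to C_{v}\to C_{v-1}\to\cdots)$ be an $R$-complex with $C_v=0$ for all $v\gg 0$, such that every module $C_v$, $v\in\mathbb Z$, is $\Gamma_{\mathfrak a}$-acyclic. Then $$\mathbf R\Gamma_{\mathfrak a}(C)\simeq\Gamma_{\mathfrak a}(C)\quad\text{in } \mathrm D(R).$$ More precisely,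 $C$ has a semiinjective resolution, and for every semiinjective resolution $\iota\colon C\to E$ the induced map $\Gamma_{\mathfrak a}(\iota)\colon\Gamma_{\mathfrak a}(C)\to\Gamma_{\mathfrak a}(E)$ is a quasiisomorphism. -/

import Mathlib

open CategoryTheory CategoryTheory.Limits

universe w u

noncomputable section

namespace DerivedSection

/-! ### The section functor -/

/-- The submodule `Γ_𝔞(M) = ⋃ₙ (0 :_M 𝔞ⁿ)` of the elements killed by some power of `𝔞`. -/
def sections {R : Type u} [CommRing R] (𝔞 : Ideal R) (M : Type u) [AddCommGroup M] [Module R M] :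
    Submodule R M where
  carrier := {x | ∃ n : ℕ, ∀ r ∈ 𝔞 ^ n, r • x = 0}
  zero_mem' := ⟨0, fun r _ => smul_zero r⟩
  add_mem' := by
    rintro x y ⟨n, hn⟩ ⟨m, hm⟩
    refine ⟨n + m, fun r hr => ?_⟩
    rw [smul_add, hn r (Ideal.pow_le_pow_right (Nat.le_add_right n m) hr),
      hm r (Ideal.pow_le_pow_right (Nat.le_add_left m n) hr), add_zero]
  smul_mem' := by
    rintro c x ⟨n, hn⟩
    exact ⟨n, fun r hr => by rw [smul_comm, hn r hr, smul_zero]⟩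

/-- The restriction of a linear map `f : M → N` to a map `Γ_𝔞(M) → Γ_𝔞(N)`. -/
def sectionsMap {R : Type u} [CommRing R] (𝔞 : Ideal R) {M N : Type u} [AddCommGroup M]
    [Module R M] [AddCommGroup N] [Module R N] (f : M →ₗ[R] N) :
    sections 𝔞 M →ₗ[R] sections 𝔞 N :=
  f.restrict (by
    rintro x ⟨n, hn⟩
    exact ⟨n, fun r hr => by rw [← map_smul, hn r hr, map_zero]⟩)

/-- The section functor `Γ_𝔞` on the category of `R`-modules. -/
def Gamma {R : Type u} [CommRing R] (𝔞 : Ideal R) : ModuleCat.{u} R ⥤ ModuleCat.{u} R where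
  obj M := ModuleCat.of R (sections 𝔞 M)
  map f := ModuleCat.ofHom (sectionsMap 𝔞 f.hom)

instance {R : Type u} [CommRing R] (𝔞 : Ideal R) : (Gamma 𝔞).Additive where

/-- A module `M` is `Γ_𝔞`-acyclic if the local cohomology modules `Hⁱ_𝔞(M) = (RⁱΓ_𝔞)(M)`
vanish for all `i > 0`. -/
def IsGammaAcyclic {R : Type u} [CommRing R] (𝔞 : Ideal R) (M : ModuleCat.{u} R) : Prop :=
  ∀ i : ℕ, 0 < i → IsZero (((Gamma 𝔞).rightDerived i).obj M)

/-! ### Complexes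

An `R`-complex `⋯ → M₁ → M₀ → M₋₁ → ⋯` is written cohomologically, with `Mⁿ = M₋ₙ`. -/

/-- The category of `R`-complexes. -/
abbrev RComplex (R : Type u) [CommRing R] := CochainComplex (ModuleCat.{u} R) ℤ

/-- The functor `Γ_𝔞` on `R`-complexes, applied degree by degree. -/
abbrev GammaComplex {R : Type u} [CommRing R] (𝔞 : Ideal R) : RComplex R ⥤ RComplex R :=
  (Gamma 𝔞).mapHomologicalComplex (ComplexShape.up ℤ)

/-- `M` is left-bounded: `Mⁿ = 0` for `n ≪ 0`, i.e. `Mᵥ = 0` for `v ≫ 0`. -/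
def IsLeftBounded {R : Type u} [CommRing R] (M : RComplex R) : Prop :=
  ∃ d : ℤ, ∀ n : ℤ, n < d → IsZero (M.X n)

/-- The map `Hom(L, I) → Hom(K, I)` of complexes of abelian groups induced by `f : K → L`. -/
def homPrecomp {R : Type u} [CommRing R] {K L : RComplex R} (f : K ⟶ L) (I : RComplex R) :
    CochainComplex.HomComplex L I ⟶ CochainComplex.HomComplex K I where
  f n := AddCommGrpCat.ofHom
    (AddMonoidHom.mk'
      (fun z : CochainComplex.HomComplex.Cochain L I n =>
        (CochainComplex.HomComplex.Cochain.ofHom f).comp z (zero_add n))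
      (fun a b => CochainComplex.HomComplex.Cochain.comp_add _ a b (zero_add n)))
  comm' i j _ := by
    ext z
    exact CochainComplex.HomComplex.δ_ofHom_comp f z j

/-- `I` is semiinjective if `Hom(-, I)` converts injective quasiisomorphisms into surjective
quasiisomorphisms. -/
def IsSemiInjective {R : Type u} [CommRing R] (I : RComplex R) : Prop :=
  ∀ ⦃K L : RComplex R⦄ (f : K ⟶ L), (∀ n, Function.Injective (f.f n)) → QuasiIso f →
    (∀ n, Function.Surjective ((homPrecomp f I).f n)) ∧ QuasiIso (homPrecomp f I)

/-- A semiinjective resolution of `M`: a semiinjective complex `I` with a quasiisomorphism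
`M → I`. -/
structure SemiInjectiveResolution {R : Type u} [CommRing R] (M : RComplex R) where
  I : RComplex R
  semiInjective : IsSemiInjective I
  ι : M ⟶ I
  quasiIso : QuasiIso ι

/-! ### Left-bounded complexes have semiinjective resolutions -/

theorem surjective_homPrecomp {R : Type u} [CommRing R] {K L : RComplex R} (f : K ⟶ L)
    (hf : ∀ n, Function.Injective (f.f n)) (I : RComplex R) (hI : ∀ n, Injective (I.X n)) (n : ℤ) :
    Function.Surjective ((homPrecomp f I).f n) := by
  intro z
  have hm : ∀ p, Mono (f.f p) := fun p => (ModuleCat.mono_iff_injective _).2 (hf p)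
  refine ⟨CochainComplex.HomComplex.Cochain.mk fun p q hpq =>
    Injective.factorThru (CochainComplex.HomComplex.Cochain.v z p q hpq) (f.f p), ?_⟩
  apply CochainComplex.HomComplex.Cochain.ext
  intro p q hpq
  refine (CochainComplex.HomComplex.Cochain.zero_cochain_comp_v _ _ p q hpq).trans ?_
  rw [CochainComplex.HomComplex.Cochain.ofHom_v, CochainComplex.HomComplex.Cochain.mk_v]
  exact Injective.comp_factorThru _ _

theorem acyclic_homComplex {R : Type u} [CommRing R] {K I : RComplex R} (hK : K.Acyclic)
    (hI : I.IsKInjective) : (CochainComplex.HomComplex K I).Acyclic := by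
  intro n
  rw [HomologicalComplex.exactAt_iff' _ (n - 1) n (n + 1) (by simp) (by simp),
    ShortComplex.ab_exact_iff]
  intro z hz
  obtain ⟨a, ha⟩ := CochainComplex.IsKInjective.eq_δ_of_cocycle
    (CochainComplex.HomComplex.Cocycle.mk z (n + 1) rfl hz) hK (n - 1) (by lia)
  exact ⟨a, ha⟩

theorem isSemiInjective_of_injective {R : Type u} [CommRing R] (I : RComplex R)
    (hb : IsLeftBounded I) (hI : ∀ n, Injective (I.X n)) : IsSemiInjective I := by
  intro K L f hf hq
  refine ⟨surjective_homPrecomp f hf I hI, ?_⟩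
  have hKI : I.IsKInjective := by
    obtain ⟨d, hd⟩ := hb
    have : I.IsStrictlyGE d := (CochainComplex.isStrictlyGE_iff _ _).2 hd
    exact CochainComplex.isKInjective_of_injective I d
  have hm : Mono f := by
    have : ∀ p, Mono (f.f p) := fun p => (ModuleCat.mono_iff_injective _).2 (hf p)
    exact HomologicalComplex.mono_of_mono_f f this
  have hac : (cokernel f).Acyclic := by
    have : (ShortComplex.mk _ _ (cokernel.condition f)).ShortExact :=
      { exact := ShortComplex.exact_cokernel f }
    exact this.acyclic_X₃ hq
  have hw : homPrecomp (cokernel.π f) I ≫ homPrecomp f I = 0 := by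
    ext n z
    apply CochainComplex.HomComplex.Cochain.ext
    intro p q hpq
    refine (CochainComplex.HomComplex.Cochain.zero_cochain_comp_v _ _ p q hpq).trans ?_
    refine (congrArg _
      (CochainComplex.HomComplex.Cochain.zero_cochain_comp_v _ _ p q hpq)).trans ?_
    rw [CochainComplex.HomComplex.Cochain.ofHom_v, CochainComplex.HomComplex.Cochain.ofHom_v,
      ← Category.assoc, ← HomologicalComplex.comp_f, cokernel.condition]
    exact zero_comp
  have hS : (ShortComplex.mk _ _ hw).ShortExact := by
    apply HomologicalComplex.shortExact_of_degreewise_shortExact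
    intro n
    have hp : ∀ p, Epi ((cokernel.π f).f p) := fun p => inferInstance
    refine ShortComplex.ShortExact.mk' ?_ ?_ ?_
    · rw [ShortComplex.ab_exact_iff]
      intro z hz
      have hz' : ∀ p q hpq, f.f p ≫ CochainComplex.HomComplex.Cochain.v z p q hpq = 0 := by
        intro p q hpq
        have := CochainComplex.HomComplex.Cochain.congr_v hz p q hpq
        refine Eq.trans ?_ this
        refine Eq.trans ?_
          (CochainComplex.HomComplex.Cochain.zero_cochain_comp_v _ _ p q hpq).symm
        rw [CochainComplex.HomComplex.Cochain.ofHom_v]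
      have hS' : ∀ p, ((ShortComplex.mk _ _ (cokernel.condition f)).map
          (HomologicalComplex.eval _ _ p)).Exact := fun p =>
        (ShortComplex.exact_cokernel f).map (HomologicalComplex.eval _ _ p)
      refine ⟨CochainComplex.HomComplex.Cochain.mk fun p q hpq =>
        haveI : Epi ((ShortComplex.mk _ _ (cokernel.condition f)).map
          (HomologicalComplex.eval _ _ p)).g := hp p
        (hS' p).desc (CochainComplex.HomComplex.Cochain.v z p q hpq) (hz' p q hpq), ?_⟩
      apply CochainComplex.HomComplex.Cochain.ext
      intro p q hpq
      refine (CochainComplex.HomComplex.Cochain.zero_cochain_comp_v _ _ p q hpq).trans ?_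
      have : Epi ((ShortComplex.mk _ _ (cokernel.condition f)).map
          (HomologicalComplex.eval _ _ p)).g := hp p
      refine (congrArg (fun t => t ≫ _)
        (CochainComplex.HomComplex.Cochain.ofHom_v (cokernel.π f) p)).trans ?_
      exact (hS' p).g_desc _ (hz' p q hpq)
    · rw [AddCommGrpCat.mono_iff_injective]
      intro a b hab
      apply CochainComplex.HomComplex.Cochain.ext
      intro p q hpq
      rw [← cancel_epi ((cokernel.π f).f p)]
      have := CochainComplex.HomComplex.Cochain.congr_v hab p q hpq
      have h1 := CochainComplex.HomComplex.Cochain.zero_cochain_comp_v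
        (CochainComplex.HomComplex.Cochain.ofHom (cokernel.π f)) a p q hpq
      have h2 := CochainComplex.HomComplex.Cochain.zero_cochain_comp_v
        (CochainComplex.HomComplex.Cochain.ofHom (cokernel.π f)) b p q hpq
      rw [CochainComplex.HomComplex.Cochain.ofHom_v] at h1 h2
      exact h1.symm.trans (this.trans h2)
    · rw [AddCommGrpCat.epi_iff_surjective]
      exact surjective_homPrecomp f hf I hI n
  have hA : ∀ n, IsZero ((CochainComplex.HomComplex (cokernel f) I).homology n) := fun n =>
    (acyclic_homComplex hac hKI n).isZero_homology
  rw [quasiIso_iff]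
  intro n
  rw [quasiIsoAt_iff_isIso_homologyMap]
  have h2 := hS.homology_exact₂ n
  have h3 := hS.homology_exact₃ n (n + 1) (by simp)
  have : Mono (HomologicalComplex.homologyMap (homPrecomp f I) n) :=
    h2.mono_g ((hA n).eq_of_src _ _)
  have : Epi (HomologicalComplex.homologyMap (homPrecomp f I) n) :=
    h3.epi_f ((hA (n + 1)).eq_of_tgt _ _)
  exact isIso_of_mono_of_epi _

theorem nonempty_semiInjectiveResolution {R : Type u} [CommRing R] {M : RComplex R}
    (hM : IsLeftBounded M) : Nonempty (SemiInjectiveResolution M) := by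
  obtain ⟨d, hd⟩ := hM
  have : M.IsStrictlyGE d := (CochainComplex.isStrictlyGE_iff _ _).2 hd
  obtain ⟨L, i, hi, hL, hLd⟩ :=
    CochainComplex.Plus.modelCategoryQuillen.exists_quasiIso_injective M d
  exact ⟨⟨L, isSemiInjective_of_injective L
    ⟨d, fun n hn => (CochainComplex.isStrictlyGE_iff _ _).1 hLd n hn⟩ hL, i, hi⟩⟩

/-! ### The right derived section functor -/

/-- `RΓ_𝔞(M) = Γ_𝔞(E)` in `D(R)`, where `E` is a (chosen) semiinjective resolution of the
left-bounded complex `M`. -/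
def RGamma {R : Type u} [CommRing R] [HasDerivedCategory.{w} (ModuleCat.{u} R)] (𝔞 : Ideal R)
    (M : RComplex R) (hM : IsLeftBounded M) : DerivedCategory (ModuleCat.{u} R) :=
  DerivedCategory.Q.obj
    ((GammaComplex 𝔞).obj (Classical.choice (nonempty_semiInjectiveResolution hM)).I)

end DerivedSection

end

/-!
The statement reduces to a comparison with one convenient resolution. A left-bounded complex `C`
embeds, by a quasiisomorphism `i : C → L`, in a left-bounded complex `L` of injective modules. A
semiinjective complex is K-injective (`IsSemiInjective.isKInjective`), so for any semiinjective
resolution `ι : C → E` the complexes `L` and `E` are homotopy equivalent under `C`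
(`exists_homotopyEquiv_of_quasiIso`). An additive functor preserves homotopies, so it suffices to
see that `Γ_𝔞(i)` is a quasiisomorphism.

The cokernel `K` of `i` is acyclic and left-bounded, and its terms are `Γ_𝔞`-acyclic. Its cycles
`Zⁿ` fit in short exact sequences `0 → Zⁿ → Kⁿ → Zⁿ⁺¹ → 0` and vanish for `n ≪ 0`, so by induction
they are `Γ_𝔞`-acyclic as well. As `Γ_𝔞` maps a short exact sequence `0 → X₁ → X₂ → X₃ → 0` with
`R¹Γ_𝔞(X₁) = 0` to a short exact sequence (`shortExact_Gamma_map`), the complex `Γ_𝔞(K)` is acyclic,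
and so is the cokernel of the injective map `Γ_𝔞(i)`, which is `Γ_𝔞(K)`.

The induction needs the part `RⁱF(X₂) → RⁱF(X₃) → Rⁱ⁺¹F(X₁)`, `i > 0`, of the long exact sequence of
right derived functors (`isZero_rightDerived_X₃`). If `f : I → J` lifts `X₁ → X₂` to
injective resolutions, then `cone(f)` is K-injective and isomorphic to `X₃` in the derived category, hence
homotopy equivalent to an injective resolution of `X₃`. So `RⁱF(X₃)` is the cohomology of
`F(cone(f)) = cone(F(f))`.
-/

namespace DerivedSection

section

variable {A : Type*} [Category* A] [Abelian A] {B : Type*} [Category* B] [Abelian B]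

/-! ### K-injective complexes and additive functors -/

theorem nonempty_homotopyEquiv_of_iso [HasDerivedCategory A] {K L : CochainComplex A ℤ}
    [K.IsKInjective] [L.IsKInjective] (e : DerivedCategory.Q.obj K ≅ DerivedCategory.Q.obj L) :
    Nonempty (HomotopyEquiv K L) := by
  let e' := (DerivedCategory.quotientCompQhIso A).app K ≪≫ e ≪≫
    ((DerivedCategory.quotientCompQhIso A).app L).symm
  obtain ⟨f, hf⟩ := (CochainComplex.IsKInjective.Qh_map_bijective _ L).surjective e'.hom
  obtain ⟨g, hg⟩ := (CochainComplex.IsKInjective.Qh_map_bijective _ K).surjective e'.inv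
  exact ⟨HomotopyCategory.homotopyEquivOfIso
    { hom := f
      inv := g
      hom_inv_id := (CochainComplex.IsKInjective.Qh_map_bijective _ K).injective (by
        rw [Functor.map_comp, hf, hg, e'.hom_inv_id]; exact (CategoryTheory.Functor.map_id _ _).symm)
      inv_hom_id := (CochainComplex.IsKInjective.Qh_map_bijective _ L).injective (by
        rw [Functor.map_comp, hf, hg, e'.inv_hom_id]; exact (CategoryTheory.Functor.map_id _ _).symm) }⟩

theorem exactAt_of_homotopyEquiv {K L : CochainComplex A ℤ} (e : HomotopyEquiv K L) {n : ℤ}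
    (h : K.ExactAt n) : L.ExactAt n := by
  rw [HomologicalComplex.exactAt_iff_isZero_homology] at h ⊢
  exact h.of_iso (e.toHomologyIso n).symm

/-- The cohomology of `F(K)`, for `K` K-injective, depends only on the class of `K` in the derived
category. -/
theorem exactAt_map_of_iso_Q [HasDerivedCategory A] (F : A ⥤ B) [F.Additive]
    {K L : CochainComplex A ℤ} [K.IsKInjective] [L.IsKInjective]
    (e : DerivedCategory.Q.obj K ≅ DerivedCategory.Q.obj L) {n : ℤ}
    (h : ((F.mapHomologicalComplex (.up ℤ)).obj K).ExactAt n) :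
    ((F.mapHomologicalComplex (.up ℤ)).obj L).ExactAt n := by
  obtain ⟨e⟩ := nonempty_homotopyEquiv_of_iso e
  exact exactAt_of_homotopyEquiv (F.mapHomotopyEquiv e) h

/-- Two K-injective resolutions of `K` are homotopy equivalent, compatibly up to homotopy with the
maps from `K`. -/
theorem exists_homotopyEquiv_of_quasiIso {K L E : CochainComplex A ℤ} [L.IsKInjective]
    [E.IsKInjective] (i : K ⟶ L) (ι : K ⟶ E) [QuasiIso i] [QuasiIso ι] :
    ∃ e : HomotopyEquiv L E, Nonempty (Homotopy (i ≫ e.hom) ι) := by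
  let := HasDerivedCategory.standard A
  let q := DerivedCategory.quotientCompQhIso A
  obtain ⟨g', hg'⟩ := (CochainComplex.IsKInjective.Qh_map_bijective _ E).surjective
    (q.hom.app L ≫ inv (DerivedCategory.Q.map i) ≫ DerivedCategory.Q.map ι ≫ q.inv.app E)
  obtain ⟨g, rfl⟩ := (HomotopyCategory.quotient _ _).map_surjective g'
  have hg : DerivedCategory.Q.map g = inv (DerivedCategory.Q.map i) ≫ DerivedCategory.Q.map ι := by
    have h := q.hom.naturality g
    rw [Functor.comp_map, hg'] at h
    rw [← cancel_epi (q.hom.app L), ← h]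
    simp only [Category.assoc, Iso.inv_hom_id_app, Category.comp_id]
  have hq : QuasiIso g := by
    rw [← DerivedCategory.isIso_Q_map_iff_quasiIso, hg]
    infer_instance
  obtain ⟨e, rfl⟩ := (CochainComplex.IsKInjective.quasiIso_iff g).1 hq
  refine ⟨e, ⟨HomotopyCategory.homotopyOfEq _ _
    ((CochainComplex.IsKInjective.Qh_map_bijective _ E).injective ?_)⟩⟩
  have h (f : K ⟶ E) : DerivedCategory.Qh.map ((HomotopyCategory.quotient _ _).map f) =
      q.hom.app K ≫ DerivedCategory.Q.map f ≫ q.inv.app E := by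
    rw [← q.hom.naturality_assoc f]
    simp
  rw [h, h, Functor.map_comp, hg, IsIso.hom_inv_id_assoc]

/-- Whether `F` maps a K-injective resolution of `K` to a quasiisomorphism does not depend on the
resolution. -/
theorem quasiIso_map_of_isKInjective (F : A ⥤ B) [F.Additive] {K L E : CochainComplex A ℤ}
    [L.IsKInjective] [E.IsKInjective] (i : K ⟶ L) (ι : K ⟶ E) [QuasiIso i] [QuasiIso ι]
    (h : QuasiIso ((F.mapHomologicalComplex (.up ℤ)).map i)) :
    QuasiIso ((F.mapHomologicalComplex (.up ℤ)).map ι) := by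
  obtain ⟨e, ⟨H⟩⟩ := exists_homotopyEquiv_of_quasiIso i ι
  have he : QuasiIso ((F.mapHomologicalComplex (.up ℤ)).map e.hom) :=
    inferInstanceAs (QuasiIso (F.mapHomotopyEquiv e).hom)
  have hie : QuasiIso ((F.mapHomologicalComplex (.up ℤ)).map (i ≫ e.hom)) := by
    rw [Functor.map_comp]
    infer_instance
  rw [quasiIso_iff] at hie ⊢
  intro n
  rw [quasiIsoAt_iff_isIso_homologyMap, ← (F.mapHomotopy H).homologyMap_eq n,
    ← quasiIsoAt_iff_isIso_homologyMap]
  exact hie n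

/-! ### Right derived functors and short exact sequences -/

theorem isZero_homologyFunctor_iff (K : CochainComplex A ℤ) (n : ℤ) :
    IsZero ((HomotopyCategory.homologyFunctor A (.up ℤ) n).obj
      ((HomotopyCategory.quotient A (.up ℤ)).obj K)) ↔ K.ExactAt n := by
  rw [HomologicalComplex.exactAt_iff_isZero_homology]
  exact ((HomotopyCategory.homologyFunctorFactors A (.up ℤ) n).app K).isZero_iff

theorem exactAt_mappingCone {K L : CochainComplex A ℤ} (f : K ⟶ L) (n m : ℤ) (h : n + 1 = m)
    (hL : L.ExactAt n) (hK : K.ExactAt m) : (CochainComplex.mappingCone f).ExactAt n := by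
  rw [← isZero_homologyFunctor_iff] at hL hK ⊢
  have hT := HomotopyCategory.mappingCone_triangleh_distinguished f
  exact ((HomotopyCategory.homologyFunctor A (.up ℤ) 0).homologySequence_exact₃ _ hT n m h
    ).isZero_of_both_zeros (hL.eq_of_src _ _) (hK.eq_of_tgt _ _)

/-- The derived functors of `F` in positive degrees, read off from the `ℤ`-indexed extension of an
injective resolution. -/
theorem exactAt_map_cochainComplex_iff [HasInjectiveResolutions A] (F : A ⥤ B) [F.Additive] {X : A}
    (P : InjectiveResolution X) (n : ℕ) :
    ((F.mapHomologicalComplex (.up ℤ)).obj P.cochainComplex).ExactAt (n + 1 : ℕ) ↔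
      IsZero ((F.rightDerived (n + 1)).obj X) := by
  rw [(P.isoRightDerivedObj F (n + 1)).isZero_iff]
  refine Iff.trans ?_ (HomologicalComplex.exactAt_iff_isZero_homology _ _)
  rw [HomologicalComplex.exactAt_iff' _ (n : ℤ) ((n + 1 : ℕ) : ℤ) ((n + 2 : ℕ) : ℤ)
    (by simp) (by simp; lia), HomologicalComplex.exactAt_iff' _ n (n + 1) (n + 2)
    (by simp) (by simp)]
  refine ShortComplex.exact_iff_of_iso (ShortComplex.isoMk
    (F.mapIso (P.cochainComplexXIso _ n rfl)) (F.mapIso (P.cochainComplexXIso _ (n + 1) rfl))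
    (F.mapIso (P.cochainComplexXIso _ (n + 2) rfl)) ?_ ?_)
  · change F.map _ ≫ F.map _ = F.map _ ≫ F.map _
    simp only [← F.map_comp, P.cochainComplex_d n (n + 1 : ℕ) n (n + 1) rfl rfl, Category.assoc,
      Iso.inv_hom_id, Category.comp_id]
  · change F.map _ ≫ F.map _ = F.map _ ≫ F.map _
    simp only [← F.map_comp, Category.assoc, Iso.inv_hom_id, Category.comp_id,
      P.cochainComplex_d (n + 1 : ℕ) (n + 2 : ℕ) (n + 1) (n + 2) rfl rfl]

/-- A fragment of the long exact sequence of right derived functors: `RⁱF(X₃)`, `i > 0`, vanishes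
if its neighbours `RⁱF(X₂)` and `Rⁱ⁺¹F(X₁)` do. -/
theorem isZero_rightDerived_X₃ [HasInjectiveResolutions A] (F : A ⥤ B) [F.Additive]
    {S : ShortComplex A} (hS : S.ShortExact) (n : ℕ)
    (h₂ : IsZero ((F.rightDerived (n + 1)).obj S.X₂))
    (h₁ : IsZero ((F.rightDerived (n + 2)).obj S.X₁)) :
    IsZero ((F.rightDerived (n + 1)).obj S.X₃) := by
  let := HasDerivedCategory.standard A
  let P₁ := injectiveResolution S.X₁
  let P₂ := injectiveResolution S.X₂
  let P₃ := injectiveResolution S.X₃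
  let φ : InjectiveResolution.Hom P₁ P₂ S.f :=
    { hom := InjectiveResolution.desc S.f P₂ P₁
      ι_f_zero_comp_hom_f_zero := by
        simpa using InjectiveResolution.desc_commutes_zero S.f P₂ P₁ }
  have hP (X : A) (P : InjectiveResolution X) : P.cochainComplex.IsKInjective :=
    CochainComplex.isKInjective_of_injective _ 0
  let e (X : A) (P : InjectiveResolution X) : DerivedCategory.Q.obj P.cochainComplex ≅
      (DerivedCategory.singleFunctor A 0).obj X :=
    (asIso (DerivedCategory.Q.map P.ι')).symm ≪≫
      (DerivedCategory.singleFunctorIsoCompQ A 0).symm.app X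
  have hφ : DerivedCategory.Q.map φ.hom' ≫ (e _ P₂).hom =
      (e _ P₁).hom ≫ (DerivedCategory.singleFunctor A 0).map S.f := by
    have h := congrArg DerivedCategory.Q.map φ.ι'_comp_hom'
    rw [Functor.map_comp, Functor.map_comp] at h
    rw [← cancel_epi (DerivedCategory.Q.map P₁.ι'), reassoc_of% h]
    simp only [e, Iso.trans_hom, Iso.symm_hom, asIso_inv, Category.assoc,
      IsIso.hom_inv_id_assoc]
    exact ((DerivedCategory.singleFunctorIsoCompQ A 0).inv.naturality S.f)
  -- In the derived category both `cone(φ)` and `X₃` complete `X₁ → X₂` to a distinguished triangle.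
  obtain ⟨eT⟩ : Nonempty (DerivedCategory.Q.obj (CochainComplex.mappingCone φ.hom') ≅
      (DerivedCategory.singleFunctor A 0).obj S.X₃) :=
    ⟨Pretriangulated.Triangle.π₃.mapIso (Pretriangulated.isoTriangleOfIso₁₂ _ _
      (DerivedCategory.mappingCone_triangle_distinguished φ.hom')
      hS.singleTriangle_distinguished (e _ P₁) (e _ P₂) hφ)⟩
  -- K-injectivity of the cone, as K-injective complexes form a triangulated subcategory.
  have hcone : (CochainComplex.mappingCone φ.hom').IsKInjective := by
    rw [CochainComplex.isKInjective_iff_rightOrthogonal]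
    exact ObjectProperty.ext_of_isTriangulatedClosed₃ _ _
      (HomotopyCategory.mappingCone_triangleh_distinguished φ.hom')
      (CochainComplex.IsKInjective.rightOrthogonal P₁.cochainComplex)
      (CochainComplex.IsKInjective.rightOrthogonal P₂.cochainComplex)
  rw [← exactAt_map_cochainComplex_iff F P₃]
  refine exactAt_map_of_iso_Q F (eT ≪≫ (e _ P₃).symm) ?_
  refine HomologicalComplex.ExactAt.of_iso ?_
    (CochainComplex.mappingCone.mapHomologicalComplexIso φ.hom' F).symm
  refine exactAt_mappingCone _ _ ((n + 2 : ℕ) : ℤ) (by simp; lia) ?_ ?_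
  · exact (exactAt_map_cochainComplex_iff F P₂ n).2 h₂
  · exact (exactAt_map_cochainComplex_iff F P₁ (n + 1)).2 h₁

/-! ### Acyclic complexes -/

theorem shortExact_cycles {K : CochainComplex A ℤ} (hK : K.Acyclic) (n : ℤ) :
    (ShortComplex.mk (K.iCycles n) (K.toCycles n (n + 1))
      (by simp [← cancel_mono (K.iCycles (n + 1))])).ShortExact where
  exact := by
    let S : ShortComplex A := ShortComplex.mk (K.iCycles n) (K.d n (n + 1)) (by simp)
    have hS : S.Exact := ShortComplex.exact_of_f_is_kernel _ (K.cyclesIsKernel n (n + 1) (by simp))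
    let φ : ShortComplex.mk (K.iCycles n) (K.toCycles n (n + 1))
        (by simp [← cancel_mono (K.iCycles (n + 1))]) ⟶ S :=
      { τ₁ := 𝟙 _
        τ₂ := 𝟙 _
        τ₃ := K.iCycles (n + 1) }
    have : Epi φ.τ₁ := inferInstanceAs (Epi (𝟙 _))
    have : IsIso φ.τ₂ := inferInstanceAs (IsIso (𝟙 _))
    have : Mono φ.τ₃ := inferInstanceAs (Mono (K.iCycles (n + 1)))
    exact (ShortComplex.exact_iff_of_epi_of_isIso_of_mono φ).2 hS
  epi_g := by
    exact Preadditive.epi_of_isZero_cokernel' _ (K.homologyIsCokernel n (n + 1) (by simp))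
      ((hK (n + 1)).isZero_homology)

theorem quasiIso_f_of_acyclic {S : ShortComplex (CochainComplex A ℤ)} (hS : S.ShortExact)
    (h : S.X₃.Acyclic) : QuasiIso S.f := by
  rw [quasiIso_iff]
  intro n
  rw [quasiIsoAt_iff_isIso_homologyMap]
  have hz (m : ℤ) : IsZero (S.X₃.homology m) := (h m).isZero_homology
  have : Mono (HomologicalComplex.homologyMap S.f n) :=
    (hS.homology_exact₁ (n - 1) n (by simp)).mono_g ((hz _).eq_of_src _ _)
  have : Epi (HomologicalComplex.homologyMap S.f n) :=
    (hS.homology_exact₂ n).epi_f ((hz _).eq_of_tgt _ _)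
  exact isIso_of_mono_of_epi _

end

/-! ### Semiinjective complexes are K-injective -/

/-- For `K` acyclic, semiinjectivity applied to the injective quasiisomorphism `0 → K` shows that
`Hom(K, E)` is acyclic. A chain map `K → E` is a cocycle of degree `0` in it, hence a coboundary,
that is, null-homotopic. -/
theorem IsSemiInjective.isKInjective {R : Type u} [CommRing R] {E : RComplex R}
    (hE : IsSemiInjective E) : E.IsKInjective where
  nonempty_homotopy_zero {K} f hK := by
    obtain ⟨Z, hZ⟩ := HasZeroObject.zero (C := RComplex R)
    have h0 : QuasiIso (0 : Z ⟶ K) := by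
      rw [quasiIso_iff]
      intro n
      rw [quasiIsoAt_iff_exactAt _ _ (HomologicalComplex.acyclic_of_isZero Z hZ n)]
      exact hK n
    have hq := (hE (0 : Z ⟶ K) (fun n => by
      have : Mono ((0 : Z ⟶ K).f n) :=
        ((HomologicalComplex.eval _ _ n).map_isZero hZ).mono _
      exact (ModuleCat.mono_iff_injective _).1 this) h0).2
    have hz : (CochainComplex.HomComplex Z E).ExactAt 0 := by
      rw [HomologicalComplex.exactAt_iff' _ (-1) 0 1 (by simp) (by simp)]
      refine ShortComplex.exact_of_isZero_X₂ _ ?_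
      refine @AddCommGrpCat.isZero_of_subsingleton _ ⟨fun a b => ?_⟩
      apply CochainComplex.HomComplex.Cochain.ext
      intro p q hpq
      exact ((HomologicalComplex.eval _ _ p).map_isZero hZ).eq_of_src _ _
    have hx : (CochainComplex.HomComplex K E).ExactAt 0 := by
      rw [HomologicalComplex.exactAt_iff_isZero_homology] at hz ⊢
      exact hz.of_iso (isoOfQuasiIsoAt (homPrecomp 0 E) 0)
    rw [HomologicalComplex.exactAt_iff' _ (-1) 0 1 (by simp) (by simp),
      ShortComplex.ab_exact_iff] at hx
    obtain ⟨a, ha⟩ := hx (CochainComplex.HomComplex.Cochain.ofHom f)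
      (CochainComplex.HomComplex.δ_ofHom f)
    refine ⟨(CochainComplex.HomComplex.Cochain.equivHomotopy f 0).symm ⟨a, ?_⟩⟩
    rw [CochainComplex.HomComplex.Cochain.ofHom_zero, add_zero]
    exact ha.symm

/-! ### Exactness properties of the section functor -/

variable {R : Type u} [CommRing R] (𝔞 : Ideal R)

theorem mem_sections_of_mono {M N : ModuleCat.{u} R} (f : M ⟶ N) [Mono f] {x : M}
    (hx : f x ∈ sections 𝔞 N) : x ∈ sections 𝔞 M := by
  obtain ⟨n, hn⟩ := hx
  refine ⟨n, fun r hr => (ModuleCat.mono_iff_injective f).1 inferInstance ?_⟩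
  rw [map_smul, hn r hr, map_zero]

/-- If `R¹Γ_𝔞(X₁) = 0`, sections of `X₃` lift to sections of `X₂`. Let `X₁ → I⁰ → I¹ → ⋯` be an
injective resolution, and extend `X₁ → I⁰` to `φ : X₂ → I⁰`. Then `X₂ → I⁰ × X₃` is injective, so
an element of `X₂` is a section as soon as its images in `I⁰` and in `X₃` are. -/
theorem surjective_Gamma_map {S : ShortComplex (ModuleCat.{u} R)} (hS : S.ShortExact)
    (h : IsZero (((Gamma 𝔞).rightDerived 1).obj S.X₁)) :
    Function.Surjective ((Gamma 𝔞).map S.g) := by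
  have := hS.mono_f
  have := hS.epi_g
  let P := injectiveResolution S.X₁
  let ι : S.X₁ ⟶ P.cocomplex.X 0 := P.ι.f 0
  have hιm : Mono ι := inferInstanceAs (Mono (P.ι.f 0))
  have hιd : ι ≫ P.cocomplex.d 0 1 = 0 := P.ι_f_zero_comp_complex_d
  have hιe : (ShortComplex.mk ι (P.cocomplex.d 0 1) hιd).Exact := P.exact₀
  let φ : S.X₂ ⟶ P.cocomplex.X 0 := Injective.factorThru ι S.f
  have hφ : S.f ≫ φ = ι := Injective.comp_factorThru _ _
  -- `φ` followed by the differential kills `X₁`, so it induces a cocycle `ψ` with values in `I¹`.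
  let ψ : S.X₃ ⟶ P.cocomplex.X 1 := hS.exact.desc (φ ≫ P.cocomplex.d 0 1)
    (by rw [reassoc_of% hφ, hιd])
  have hψ : S.g ≫ ψ = φ ≫ P.cocomplex.d 0 1 := hS.exact.g_desc _ _
  have hψd : ψ ≫ P.cocomplex.d 1 2 = 0 := by
    rw [← cancel_epi S.g, reassoc_of% hψ, P.cocomplex.d_comp_d, comp_zero, comp_zero]
  have hex := (HomologicalComplex.exactAt_iff_isZero_homology
    (((Gamma 𝔞).mapHomologicalComplex _).obj P.cocomplex) 1).2
      (h.of_iso (P.isoRightDerivedObj (Gamma 𝔞) 1).symm)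
  rw [HomologicalComplex.exactAt_iff' _ 0 1 2 (by simp) (by simp),
    ShortComplex.moduleCat_exact_iff] at hex
  intro c
  obtain ⟨b, hb⟩ := (ModuleCat.epi_iff_surjective S.g).1 inferInstance c.1
  -- The image of the section `c` under `ψ` is a cocycle of `Γ_𝔞(I)`, and `H¹(Γ_𝔞(I)) = 0`.
  obtain ⟨t, ht⟩ := hex ((Gamma 𝔞).map ψ c) (Subtype.ext (ConcreteCategory.congr_hom hψd c.1))
  have ht' : P.cocomplex.d 0 1 t.1 = P.cocomplex.d 0 1 (φ b) := by
    refine (congrArg Subtype.val ht).trans ?_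
    change ψ c.1 = _
    rw [← hb]
    exact ConcreteCategory.congr_hom hψ b
  -- Now `φ b - t` is a cocycle in `I⁰`, so it comes from `a : X₁`; the lift `b - a` of `c` then has
  -- image `t` in `I⁰`.
  obtain ⟨a, ha⟩ := (ShortComplex.moduleCat_exact_iff _).1 hιe (φ b - t.1) (by
    change P.cocomplex.d 0 1 _ = 0
    rw [map_sub, ht', sub_self])
  change ι a = φ b - t.1 at ha
  have hφa : φ (S.f a) = φ b - t.1 := (ConcreteCategory.congr_hom hφ a).trans ha
  have hga : S.g (S.f a) = 0 := ConcreteCategory.congr_hom S.zero a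
  have hφx : φ (b - S.f a) = t.1 := by rw [map_sub, hφa, sub_sub_cancel]
  have hgx : S.g (b - S.f a) = c.1 := by rw [map_sub, hga, sub_zero, hb]
  refine ⟨⟨b - S.f a, ?_⟩, Subtype.ext hgx⟩
  obtain ⟨n, hn⟩ := t.2
  obtain ⟨m, hm⟩ := c.2
  refine ⟨n + m, fun r hr => ?_⟩
  obtain ⟨y, hy⟩ := (ShortComplex.moduleCat_exact_iff _).1 hS.exact (r • (b - S.f a)) (by
    rw [map_smul, hgx, hm r (Ideal.pow_le_pow_right (Nat.le_add_left m n) hr)])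
  have hy0 : ι y = 0 := by
    rw [← hφ, ConcreteCategory.comp_apply, hy, map_smul, hφx,
      hn r (Ideal.pow_le_pow_right (Nat.le_add_right n m) hr)]
  rw [← hy, (ModuleCat.mono_iff_injective ι).1 hιm (hy0.trans (map_zero _).symm), map_zero]

theorem shortExact_Gamma_map {S : ShortComplex (ModuleCat.{u} R)} (hS : S.ShortExact)
    (h : IsZero (((Gamma 𝔞).rightDerived 1).obj S.X₁)) :
    (S.map (Gamma 𝔞)).ShortExact := by
  have := hS.mono_f
  have := hS.epi_g
  refine ShortComplex.ShortExact.mk' ?_ ?_ ?_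
  · rw [ShortComplex.moduleCat_exact_iff]
    intro x hx
    obtain ⟨y, hy⟩ := (ShortComplex.moduleCat_exact_iff _).1 hS.exact x.1 (congrArg Subtype.val hx)
    exact ⟨⟨y, mem_sections_of_mono 𝔞 S.f (hy ▸ x.2)⟩, Subtype.ext hy⟩
  · rw [ModuleCat.mono_iff_injective]
    intro x y hxy
    exact Subtype.ext ((ModuleCat.mono_iff_injective S.f).1 inferInstance
      (congrArg Subtype.val hxy))
  · rw [ModuleCat.epi_iff_surjective]
    exact surjective_Gamma_map 𝔞 hS h

/-! ### Complexes of acyclic modules -/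

theorem IsGammaAcyclic.X₃ {S : ShortComplex (ModuleCat.{u} R)} (hS : S.ShortExact)
    (h₁ : IsGammaAcyclic 𝔞 S.X₁) (h₂ : IsGammaAcyclic 𝔞 S.X₂) : IsGammaAcyclic 𝔞 S.X₃ := by
  intro i hi
  obtain ⟨n, rfl⟩ : ∃ n, i = n + 1 := ⟨i - 1, by lia⟩
  exact isZero_rightDerived_X₃ _ hS n (h₂ _ (by lia)) (h₁ _ (by lia))

theorem isGammaAcyclic_of_injective (M : ModuleCat.{u} R) [Injective M] :
    IsGammaAcyclic 𝔞 M := by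
  intro i hi
  obtain ⟨n, rfl⟩ : ∃ n, i = n + 1 := ⟨i - 1, by lia⟩
  exact (Gamma 𝔞).isZero_rightDerived_obj_injective_succ n M

theorem isGammaAcyclic_cycles {K : RComplex R} (hK : K.Acyclic) (hb : IsLeftBounded K)
    (h : ∀ n, IsGammaAcyclic 𝔞 (K.X n)) (n : ℤ) : IsGammaAcyclic 𝔞 (K.cycles n) := by
  obtain ⟨d, hd⟩ := hb
  have hz (m : ℤ) (hm : m < d) : IsGammaAcyclic 𝔞 (K.cycles m) := by
    have : IsZero (K.cycles m) := IsZero.of_mono (K.iCycles m) (hd m hm)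
    have := this.injective
    exact isGammaAcyclic_of_injective 𝔞 _
  -- The induction starts at `d - 1`, the last degree where `K` is known to vanish.
  have hs (k : ℕ) : IsGammaAcyclic 𝔞 (K.cycles (d - 1 + k)) := by
    induction k with
    | zero => exact hz _ (by lia)
    | succ k ih =>
      rw [Nat.cast_succ, ← add_assoc]
      exact IsGammaAcyclic.X₃ 𝔞 (shortExact_cycles hK _) ih (h _)
  obtain hn | hn := lt_or_ge n d
  · exact hz n hn
  · obtain ⟨k, hk⟩ := Int.eq_ofNat_of_zero_le (a := n - (d - 1)) (by lia)
    obtain rfl : n = d - 1 + k := by lia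
    exact hs k

theorem acyclic_GammaComplex {K : RComplex R} (hK : K.Acyclic) (hb : IsLeftBounded K)
    (h : ∀ n, IsGammaAcyclic 𝔞 (K.X n)) : ((GammaComplex 𝔞).obj K).Acyclic := by
  intro n
  obtain ⟨m, rfl⟩ : ∃ m, n = m + 1 := ⟨n - 1, by lia⟩
  rw [HomologicalComplex.exactAt_iff' _ m (m + 1) (m + 1 + 1) (by simp) (by simp),
    ShortComplex.moduleCat_exact_iff]
  intro x hx
  have hc := shortExact_cycles hK
  have hm := (hc (m + 1)).mono_f
  obtain ⟨z, hz⟩ := (ShortComplex.moduleCat_exact_iff _).1 (hc (m + 1)).exact x.1 (by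
    have := congrArg Subtype.val hx
    apply (ModuleCat.mono_iff_injective (K.iCycles (m + 1 + 1))).1 inferInstance
    rw [map_zero, ← ConcreteCategory.comp_apply]
    change (K.toCycles _ _ ≫ K.iCycles _) x.1 = _
    rw [K.toCycles_i]
    exact this)
  obtain ⟨y, hy⟩ := surjective_Gamma_map 𝔞 (hc m)
    (isGammaAcyclic_cycles 𝔞 hK hb h m 1 one_pos)
    ⟨z, mem_sections_of_mono 𝔞 (K.iCycles (m + 1)) (hz ▸ x.2)⟩
  refine ⟨y, Subtype.ext ?_⟩
  have hy' : K.toCycles m (m + 1) y.1 = z := congrArg Subtype.val hy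
  refine Eq.trans ?_ hz
  change K.d m (m + 1) y.1 = K.iCycles (m + 1) z
  rw [← hy']
  exact (ConcreteCategory.congr_hom (K.toCycles_i m (m + 1)) y.1).symm

theorem quasiIso_GammaComplex_map_of_mono {C L : RComplex R} (i : C ⟶ L) [Mono i] [QuasiIso i]
    (hL : IsLeftBounded L) (hCa : ∀ n, IsGammaAcyclic 𝔞 (C.X n))
    (hLa : ∀ n, IsGammaAcyclic 𝔞 (L.X n)) : QuasiIso ((GammaComplex 𝔞).map i) := by
  have hS : (ShortComplex.mk _ _ (cokernel.condition i)).ShortExact :=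
    { exact := ShortComplex.exact_cokernel i }
  have hSn (n : ℤ) := hS.map_of_exact (HomologicalComplex.eval _ _ n)
  have hQ : IsLeftBounded (cokernel i) := by
    obtain ⟨d, hd⟩ := hL
    exact ⟨d, fun n hn => IsZero.of_epi ((cokernel.π i).f n) (hd n hn)⟩
  have hA : ((GammaComplex 𝔞).obj (cokernel i)).Acyclic :=
    acyclic_GammaComplex 𝔞 (hS.acyclic_X₃ inferInstance) hQ
      (fun n => IsGammaAcyclic.X₃ 𝔞 (hSn n) (hCa n) (hLa n))
  refine quasiIso_f_of_acyclic (S := (ShortComplex.mk _ _ (cokernel.condition i)).map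
    (GammaComplex 𝔞)) ?_ hA
  apply HomologicalComplex.shortExact_of_degreewise_shortExact
  intro n
  exact shortExact_Gamma_map 𝔞 (hSn n) (hCa n 1 one_pos)

theorem quasiIso_GammaComplex_map_ι {C : RComplex R} (hC : IsLeftBounded C)
    (hCa : ∀ n, IsGammaAcyclic 𝔞 (C.X n)) (E : SemiInjectiveResolution C) :
    QuasiIso ((GammaComplex 𝔞).map E.ι) := by
  obtain ⟨d, hd⟩ := hC
  have : C.IsStrictlyGE d := (CochainComplex.isStrictlyGE_iff _ _).2 hd
  obtain ⟨L, i, _, _, hLi, hLd⟩ :=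
    CochainComplex.Plus.modelCategoryQuillen.exists_mono_quasiIso_injective C (d - 1) d (by lia)
  have := CochainComplex.isKInjective_of_injective L (d - 1)
  have := E.semiInjective.isKInjective
  have := E.quasiIso
  exact quasiIso_map_of_isKInjective _ i E.ι (quasiIso_GammaComplex_map_of_mono 𝔞 i
    ⟨d - 1, fun n hn => (CochainComplex.isStrictlyGE_iff _ _).1 hLd n hn⟩ hCa
    fun n => isGammaAcyclic_of_injective 𝔞 _)

end DerivedSection

theorem mainTheorem5 {R : Type u} [CommRing R] [IsNoetherianRing R]
    [HasDerivedCategory.{w} (ModuleCat.{u} R)] (𝔞 : Ideal R) (h𝔞 : 𝔞 ≠ ⊤)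
    (C : DerivedSection.RComplex R) (hC : DerivedSection.IsLeftBounded C)
    (hacyclic : ∀ n : ℤ, DerivedSection.IsGammaAcyclic 𝔞 (C.X n)) :
    Nonempty (DerivedSection.RGamma 𝔞 C hC ≅
      DerivedCategory.Q.obj ((DerivedSection.GammaComplex 𝔞).obj C)) ∧
    ∀ E : DerivedSection.SemiInjectiveResolution C,
      QuasiIso ((DerivedSection.GammaComplex 𝔞).map E.ι) := by
  have h := DerivedSection.quasiIso_GammaComplex_map_ι 𝔞 hC hacyclic
  have := h (Classical.choice (DerivedSection.nonempty_semiInjectiveResolution hC))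
  exact ⟨⟨(asIso (DerivedCategory.Q.map ((DerivedSection.GammaComplex 𝔞).map
    (Classical.choice (DerivedSection.nonempty_semiInjectiveResolution hC)).ι))).symm⟩, h⟩
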